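/- Let $R$ be a Gorenstein local ring (a commutative Noetherian local ring of finite injective dimension as a module over itself) of Krull dimension one, and let $I=(a,b)$ be an ideal of $R$ generated by two regular elements (non-zero-divisors) $a$ and $b$. Then $I$ is rigid, that is, $\operatorname{Ext}^1_R(I,I)=0$, if and only if \[ ((a):b)\cap((b):a)=((a):b)\cdot((b):a), \] where $((x):y)=\{r\in R : ry\in (x)\}$. -/

import Mathlib

universe u

open CategoryTheory Abelian

/-- A commutative ring is a Gorenstein local ring if it is Noetherian, local and of finite injective
dimension as a module over itself. -/
class IsGorensteinLocalRing (R : Type u) [CommRing R] : Prop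
    extends IsNoetherianRing R, IsLocalRing R where
  exists_hasInjectiveDimensionLE : ∃ n : ℕ, HasInjectiveDimensionLE (ModuleCat.of R R) n

/-- An `R`-module `M` is rigid if `Ext¹_R(M, M) = 0`. -/
def IsRigidModule (R : Type u) [CommRing R] (M : Type u) [AddCommGroup M] [Module R M] : Prop :=
  Subsingleton (Ext (ModuleCat.of R M) (ModuleCat.of R M) 1)

/-! Put `K = (b) : a = (b) : I` and `L = (a) : b`. A map to `I` from the syzygies of `(a, b)` is
determined by its value `c` at the Koszul syzygy `(b, -a)`. The possible values are the `c` with `Kc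
⊆ bI`, and the maps extending to `R²` are those with `c ∈ I²`.

The Gorenstein hypothesis gives the duality `(x) : ((x) : J) = J` for `x ∈ J` regular
(`span_singleton_colon_colon`). With `I = (b) : K`, the possible values form `(b²) : K²`, so
rigidity means `(b²) : K² = I²`. Dualizing in `(b²)` turns this into `(b²) : I² = K²`. Multiplied by
`a`, the two sides become `b(L ∩ K)` and `bLK`; then `b` cancels. -/

/-- The short complex `0 → R → R → R ⧸ (x) → 0` given by multiplication by `x`. -/
noncomputable abbrev mulShortComplex {R : Type u} [CommRing R] (x : R) :
    ShortComplex (ModuleCat.{u} R) :=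
  ModuleCat.shortComplexOfCompEqZero (LinearMap.lsmul R R x) (Ideal.span {x}).mkQ (by
    ext
    simp)

theorem mulShortComplex_shortExact {R : Type u} [CommRing R] {x : R} (hx : IsRegular x) :
    (mulShortComplex x).ShortExact := by
  apply ModuleCat.shortComplex_shortExact
  · intro y
    change (Ideal.span {x}).mkQ y = 0 ↔ ∃ z, x * z = y
    rw [Submodule.mkQ_apply, Submodule.Quotient.mk_eq_zero, Ideal.mem_span_singleton']
    simp only [mul_comm x]
  · exact hx.left
  · exact Submodule.mkQ_surjective _

theorem mulShortComplex_f {R : Type u} [CommRing R] (x : R) :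
    (mulShortComplex x).f = x • 𝟙 (ModuleCat.of R R) := by
  ext
  rfl

theorem smul_ext_eq_zero {R : Type u} [CommRing R] {x : R} {M N : ModuleCat.{u} R} {n : ℕ}
    (hM : ∀ m : M, x • m = 0) (e : Ext M N n) : x • e = 0 := by
  have h0 : x • 𝟙 M = 0 := by
    ext m
    exact hM m
  have : x • e = (Ext.mk₀ (x • 𝟙 M)).comp e (zero_add n) := by simp [Ext.mk₀_smul]
  rw [this, h0]
  simp

/-- A map to `R ⧸ (x)` extends along an inclusion of modules killed by `x` if the
second `Ext` group of the cokernel with values in `R` vanishes. -/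
theorem exists_extension_of_subsingleton_ext {R : Type u} [CommRing R] {x : R} (hx : IsRegular x)
    {S : ShortComplex (ModuleCat.{u} R)} (hS : S.ShortExact)
    (h2 : Subsingleton (Ext S.X₃ (ModuleCat.of R R) 2)) (hM : ∀ m : S.X₂, x • m = 0)
    (f : S.X₁ ⟶ ModuleCat.of R (R ⧸ Ideal.span {x})) :
    ∃ g : S.X₂ ⟶ ModuleCat.of R (R ⧸ Ideal.span {x}), S.f ≫ g = f := by
  have hT := mulShortComplex_shortExact hx
  have hN : ∀ m : S.X₁, x • m = 0 := fun m => hS.moduleCat_injective_f (by simp [hM])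
  -- The obstruction to lifting `f` to `R` extends to `S.X₂`. There it is killed by `x`, so it comes
  -- from a map `g` to `R ⧸ (x)`.
  obtain ⟨e, he⟩ := Ext.contravariant_sequence_exact₁ hS _
    ((Ext.mk₀ f).comp hT.extClass (zero_add 1)) (rfl : 1 + 1 = 2) (Subsingleton.elim _ _)
  obtain ⟨g', hg⟩ := Ext.covariant_sequence_exact₁ _ hT e
    (by rw [mulShortComplex_f, ← Ext.smul_eq_comp_mk₀, smul_ext_eq_zero hM]) (zero_add 1)
  obtain ⟨g, rfl⟩ := Ext.addEquiv₀.symm.surjective g'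
  refine ⟨g, ?_⟩
  -- The error factors through a map `S.X₁ ⟶ R`, which vanishes because `x` kills its source and is
  -- regular on `R`.
  obtain ⟨h', hh⟩ := Ext.covariant_sequence_exact₃ _ hT (Ext.mk₀ (S.f ≫ g - f)) (zero_add 1) (by
    rw [← Ext.addEquiv₀_symm_apply, map_sub, sub_eq_add_neg, Ext.add_comp, Ext.neg_comp,
      ← sub_eq_add_neg, sub_eq_zero, Ext.addEquiv₀_symm_apply, Ext.addEquiv₀_symm_apply, ← he,
      ← hg, Ext.addEquiv₀_symm_apply, ← Ext.mk₀_comp_mk₀, Ext.comp_assoc_of_second_deg_zero])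
  obtain ⟨h, rfl⟩ := Ext.addEquiv₀.symm.surjective h'
  have h0 : h = 0 := by
    ext m
    apply hx.left
    change x • h m = x • 0
    rw [← map_smul, hN, map_zero, smul_zero]
  rw [h0] at hh
  simp only [map_zero, Ext.zero_comp] at hh
  exact sub_eq_zero.1 ((Ext.mk₀_eq_zero_iff _).1 hh.symm)

theorem subsingleton_ext_quotient_span_singleton {R : Type u} [CommRing R] {x : R}
    (hx : IsRegular x) (N : ModuleCat.{u} R) {n : ℕ} (hn : 2 ≤ n) :
    Subsingleton (Ext (ModuleCat.of R (R ⧸ Ideal.span {x})) N n) := by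
  obtain ⟨n, rfl⟩ := Nat.exists_eq_add_of_le' hn
  refine subsingleton_of_forall_eq 0 fun e => ?_
  have : Projective (ModuleCat.of R R) := inferInstance
  obtain ⟨e', rfl⟩ := Ext.contravariant_sequence_exact₃ (mulShortComplex_shortExact hx) N e
    (Ext.eq_zero_of_projective (P := ModuleCat.of R R) (n := n + 1) _) (n₀ := n + 1) (by lia)
  rw [Ext.eq_zero_of_projective (P := ModuleCat.of R R) e']
  simp

theorem subsingleton_ext_of_shortExact {R : Type u} [CommRing R]
    {S : ShortComplex (ModuleCat.{u} R)} (hS : S.ShortExact) {N : ModuleCat.{u} R} {n : ℕ}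
    (h1 : Subsingleton (Ext S.X₁ N n)) (h3 : Subsingleton (Ext S.X₃ N n)) :
    Subsingleton (Ext S.X₂ N n) := by
  refine subsingleton_of_forall_eq 0 fun e => ?_
  obtain ⟨e', rfl⟩ := Ext.contravariant_sequence_exact₂ hS N e (Subsingleton.elim _ _)
  rw [Subsingleton.elim e' 0, Ext.comp_zero]

theorem subsingleton_ext_left_of_shortExact {R : Type u} [CommRing R]
    {S : ShortComplex (ModuleCat.{u} R)} (hS : S.ShortExact) {N : ModuleCat.{u} R} {n : ℕ}
    (h2 : Subsingleton (Ext S.X₂ N n)) (h3 : Subsingleton (Ext S.X₃ N (1 + n))) :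
    Subsingleton (Ext S.X₁ N n) := by
  refine subsingleton_of_forall_eq 0 fun e => ?_
  obtain ⟨e', rfl⟩ := Ext.contravariant_sequence_exact₁ hS N e rfl (Subsingleton.elim _ _)
  rw [Subsingleton.elim e' 0, Ext.comp_zero]

theorem subsingleton_ext_of_linearEquiv {R : Type u} [CommRing R] {M M' : Type u}
    [AddCommGroup M] [Module R M] [AddCommGroup M'] [Module R M'] (f : M ≃ₗ[R] M')
    {N : ModuleCat.{u} R} {n : ℕ} (h : Subsingleton (Ext (ModuleCat.of R M') N n)) :
    Subsingleton (Ext (ModuleCat.of R M) N n) := by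
  refine subsingleton_of_forall_eq 0 fun e => ?_
  have h1 : e = (Ext.mk₀ f.toModuleIso.hom).comp ((Ext.mk₀ f.toModuleIso.inv).comp e (zero_add n))
      (zero_add n) := by
    rw [← Ext.comp_assoc_of_second_deg_zero, Ext.mk₀_comp_mk₀, Iso.hom_inv_id, Ext.mk₀_id_comp]
  rw [h1, Subsingleton.elim ((Ext.mk₀ f.toModuleIso.inv).comp e (zero_add n)) 0, Ext.comp_zero]

/-! ### Vanishing of `Ext` and colon duality in dimension one -/

section DimensionOne

variable {R : Type u} [CommRing R] [IsLocalRing R]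

theorem eq_maximalIdeal_of_isRegular_mem (hdim : ringKrullDim R ≤ 1) {x : R} (hx : IsRegular x)
    {p : Ideal R} (hp : p.IsPrime) (hxp : x ∈ p) : p = IsLocalRing.maximalIdeal R := by
  have h1 : Ring.KrullDimLE 1 R := (Order.krullDimLE_iff ..).2 hdim
  refine IsLocalRing.eq_maximalIdeal ((Ring.krullDimLE_one_iff.1 h1 p hp).resolve_left fun h => ?_)
  exact notMem_nonZeroDivisors_of_mem_mem_minimalPrimes hxp h hx.mem_nonZeroDivisors

variable [IsNoetherianRing R]

/-- An associated prime of `R ⧸ (x)` contains the regular element `x`, hence is maximal. -/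
theorem exists_injective_residueField_quotient (hdim : ringKrullDim R ≤ 1) {x : R}
    (hx : IsRegular x) (hxm : x ∈ IsLocalRing.maximalIdeal R) :
    ∃ f : (R ⧸ IsLocalRing.maximalIdeal R) →ₗ[R] (R ⧸ Ideal.span {x}), Function.Injective f := by
  have : Nontrivial (R ⧸ Ideal.span {x}) := Ideal.Quotient.nontrivial_iff.2 fun h =>
    (IsLocalRing.maximalIdeal.isMaximal R).ne_top
      (top_le_iff.1 (h ▸ (Ideal.span_singleton_le_iff_mem _).2 hxm))
  obtain ⟨p, hp⟩ := associatedPrimes.nonempty R (R ⧸ Ideal.span {x})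
  have hp' : IsAssociatedPrime p (R ⧸ Ideal.span {x}) := hp
  obtain ⟨hpr, f, hf⟩ := (isAssociatedPrime_iff_exists_injective_linearMap _ _).1 hp'
  have hxp : x ∈ p := by
    have h0 : (Ideal.Quotient.mk p x) = 0 := hf (by
      rw [map_zero, show Ideal.Quotient.mk p x = x • (1 : R ⧸ p) by
        rw [Algebra.smul_def, mul_one]; rfl, map_smul]
      obtain ⟨y, hy⟩ := Ideal.Quotient.mk_surjective (f 1)
      rw [← hy, Algebra.smul_def]
      change Ideal.Quotient.mk _ x * _ = 0
      rw [Ideal.Quotient.eq_zero_iff_mem.2 (Ideal.mem_span_singleton_self x), zero_mul])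
    exact Ideal.Quotient.eq_zero_iff_mem.1 h0
  obtain rfl := eq_maximalIdeal_of_isRegular_mem hdim hx hpr hxp
  exact ⟨f, hf⟩

/-- If `x` is regular, the vanishing of `Ext` on the residue field propagates to all
finitely generated modules killed by `x`. -/
theorem subsingleton_ext_of_residueField (hdim : ringKrullDim R ≤ 1) {x : R}
    (hx : IsRegular x) {N : ModuleCat.{u} R} {n : ℕ}
    (h : Subsingleton (Ext (ModuleCat.of R (R ⧸ IsLocalRing.maximalIdeal R)) N n))
    (M : Type u) [AddCommGroup M] [Module R M] [hfin : Module.Finite R M]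
    (hM : ∀ m : M, x • m = 0) :
    Subsingleton (Ext (ModuleCat.of R M) N n) := by
  induction hfin using IsNoetherianRing.induction_on_isQuotientEquivQuotientPrime R with
  | subsingleton M =>
    refine subsingleton_of_forall_eq 0 fun e => ?_
    have h0 : 𝟙 (ModuleCat.of R M) = 0 := by
      ext m
      exact Subsingleton.elim (α := M) _ _
    rw [← e.mk₀_id_comp, h0]
    simp
  | quotient M p f =>
    have hxp : x ∈ p.1 := by
      have h0 := hM (f.symm 1)
      rw [← map_smul, map_eq_zero_iff _ f.symm.injective, Algebra.smul_def, mul_one] at h0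
      exact Ideal.Quotient.eq_zero_iff_mem.1 h0
    have := eq_maximalIdeal_of_isRegular_mem hdim hx p.2 hxp
    rw [this] at f
    exact subsingleton_ext_of_linearEquiv f h
  | exact M₁ M₂ M₃ f g hf hg hfg h1 h3 =>
    have hS : (ModuleCat.shortComplexOfCompEqZero f g hfg.linearMap_comp_eq_zero).ShortExact :=
      ModuleCat.shortComplex_shortExact _ hfg hf hg
    refine subsingleton_ext_of_shortExact hS (h1 fun m => hf (by simp [hM])) (h3 fun m => ?_)
    obtain ⟨m, rfl⟩ := hg m
    rw [← map_smul, hM, map_zero]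

end DimensionOne

/-- Over a one-dimensional Gorenstein local ring, `Extⁱ(M, R) = 0` for `i ≥ 2` and every
finitely generated module `M` killed by a regular nonunit. -/
theorem subsingleton_ext_self_of_smul_eq_zero {R : Type u} [CommRing R] [IsGorensteinLocalRing R]
    (hdim : ringKrullDim R ≤ 1) {x : R} (hx : IsRegular x)
    (hxm : x ∈ IsLocalRing.maximalIdeal R) {n : ℕ} (hn : 2 ≤ n)
    (M : Type u) [AddCommGroup M] [Module R M] [Module.Finite R M]
    (hM : ∀ m : M, x • m = 0) :
    Subsingleton (Ext (ModuleCat.of R M) (ModuleCat.of R R) n) := by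
  obtain ⟨d, hd⟩ := IsGorensteinLocalRing.exists_hasInjectiveDimensionLE (R := R)
  obtain ⟨f, hf⟩ := exists_injective_residueField_quotient hdim hx hxm
  -- Descending induction on the degree: `k` bounds how far `n` lies below `d + 1`, where injective
  -- dimension forces vanishing.
  have key : ∀ k n : ℕ, 2 ≤ n → d + 1 ≤ n + k → ∀ (M : Type u) [AddCommGroup M] [Module R M]
      [Module.Finite R M], (∀ m : M, x • m = 0) →
      Subsingleton (Ext (ModuleCat.of R M) (ModuleCat.of R R) n) := by
    intro k
    induction k with
    | zero =>
      intro n _ hdn M _ _ _ _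
      exact HasInjectiveDimensionLT.subsingleton (ModuleCat.of R R) (d + 1) n hdn _
    | succ k ih =>
      intro n hn hdn M _ _ _ hM
      have hfg := f.exact_map_mkQ_range
      have hS : (ModuleCat.shortComplexOfCompEqZero f (LinearMap.range f).mkQ
          hfg.linearMap_comp_eq_zero).ShortExact :=
        ModuleCat.shortComplex_shortExact _ hfg hf (Submodule.mkQ_surjective _)
      refine subsingleton_ext_of_residueField hdim hx ?_ M hM
      refine subsingleton_ext_left_of_shortExact hS
        (subsingleton_ext_quotient_span_singleton hx _ hn)
        (ih (1 + n) (by lia) (by lia) _ fun m => ?_)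
      obtain ⟨m, rfl⟩ := Submodule.mkQ_surjective _ m
      obtain ⟨m, rfl⟩ := Submodule.mkQ_surjective _ m
      rw [← map_smul, ← map_smul, smul_eq_mul, mul_comm, ← smul_eq_mul]
      have : (Ideal.span {x}).mkQ (m • x) = 0 := by
        rw [Submodule.mkQ_apply, Submodule.Quotient.mk_eq_zero]
        exact Ideal.mul_mem_left _ _ (Ideal.mem_span_singleton_self x)
      rw [this, map_zero]
  exact key (d + 1) n hn (by lia) M hM

/-- If `s ∉ J`, the submodule of `R ⧸ J` generated by `s` maps onto the residue field, which embeds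
in `R ⧸ (x)`. This map extends to `R ⧸ J`, giving `t ∈ (x) : J` with `st ∉ (x)`. -/
theorem span_singleton_colon_colon {R : Type u} [CommRing R] [IsGorensteinLocalRing R]
    (hdim : ringKrullDim R ≤ 1) {x : R} (hx : IsRegular x) {J : Ideal R} (hxJ : x ∈ J) :
    (Ideal.span {x}).colon ((Ideal.span {x}).colon (J : Set R) : Set R) = J := by
  refine le_antisymm (fun s hs => ?_) fun s hs => Submodule.mem_colon.2 fun t ht => ?_
  · by_contra hsJ
    have hxm : x ∈ IsLocalRing.maximalIdeal R := by
      rw [IsLocalRing.mem_maximalIdeal, mem_nonunits_iff]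
      exact fun h => hsJ (Ideal.eq_top_of_isUnit_mem _ hxJ h ▸ Submodule.mem_top)
    obtain ⟨φ, hφ⟩ := exists_injective_residueField_quotient hdim hx hxm
    let σ : R →ₗ[R] (R ⧸ J) := LinearMap.toSpanSingleton R _ (Submodule.Quotient.mk s)
    have hσ : LinearMap.ker σ ≤ IsLocalRing.maximalIdeal R := by
      refine IsLocalRing.le_maximalIdeal fun h => hsJ ?_
      have h1 : σ 1 = 0 := by rw [← LinearMap.mem_ker, h]; trivial
      rw [LinearMap.toSpanSingleton_apply, one_smul] at h1
      exact (Submodule.Quotient.mk_eq_zero _).1 h1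
    let f : LinearMap.range σ →ₗ[R] (R ⧸ Ideal.span {x}) :=
      φ ∘ₗ Submodule.factor hσ ∘ₗ σ.quotKerEquivRange.symm.toLinearMap
    have hf : f ⟨σ 1, 1, rfl⟩ ≠ 0 := by
      have h1 : σ.quotKerEquivRange.symm ⟨σ 1, 1, rfl⟩ = Submodule.Quotient.mk 1 := by
        rw [LinearEquiv.symm_apply_eq]
        rfl
      change φ (Submodule.factor hσ (σ.quotKerEquivRange.symm ⟨σ 1, 1, rfl⟩)) ≠ 0
      rw [h1, Ne, map_eq_zero_iff _ hφ]
      change ¬ (Submodule.Quotient.mk 1 : R ⧸ IsLocalRing.maximalIdeal R) = 0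
      rw [Submodule.Quotient.mk_eq_zero]
      exact (Ideal.ne_top_iff_one _).1 (IsLocalRing.maximalIdeal.isMaximal R).ne_top
    have hkill : ∀ m : R ⧸ J, x • m = 0 := fun m => by
      obtain ⟨m, rfl⟩ := Submodule.mkQ_surjective _ m
      rw [← map_smul, Submodule.mkQ_apply, Submodule.Quotient.mk_eq_zero]
      exact Ideal.mul_mem_right _ _ hxJ
    have hfg : Function.Exact (LinearMap.range σ).subtype (LinearMap.range σ).mkQ :=
      LinearMap.exact_subtype_mkQ _
    obtain ⟨g, hg⟩ := exists_extension_of_subsingleton_ext hx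
      (ModuleCat.shortComplex_shortExact (ModuleCat.shortComplexOfCompEqZero
        (LinearMap.range σ).subtype (LinearMap.range σ).mkQ hfg.linearMap_comp_eq_zero) hfg
        (Submodule.injective_subtype _) (Submodule.mkQ_surjective _))
      (subsingleton_ext_self_of_smul_eq_zero hdim hx hxm le_rfl _ fun m => by
        obtain ⟨m, rfl⟩ := Submodule.mkQ_surjective _ m
        rw [← map_smul, hkill, map_zero]) hkill (ModuleCat.ofHom f)
    let ψ : (R ⧸ J) →ₗ[R] (R ⧸ Ideal.span {x}) := g.hom
    have hψ : ψ (σ 1) ≠ 0 := by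
      have : ψ (σ 1) = f ⟨σ 1, 1, rfl⟩ :=
        congrArg (fun k => k.hom ⟨σ 1, 1, rfl⟩) hg
      rwa [this]
    obtain ⟨t, ht⟩ := Submodule.mkQ_surjective _ (ψ (Submodule.Quotient.mk 1))
    have hψt (r : R) : ψ (Submodule.Quotient.mk r) = Submodule.Quotient.mk (r * t) := by
      have : (Submodule.Quotient.mk r : R ⧸ J) = r • Submodule.Quotient.mk 1 := by
        rw [← Submodule.Quotient.mk_smul, smul_eq_mul, mul_one]
      rw [this, map_smul, ← ht]
      rfl
    refine hψ ?_
    rw [LinearMap.toSpanSingleton_apply, one_smul, hψt, Submodule.Quotient.mk_eq_zero]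
    refine Submodule.mem_colon.1 hs t (Submodule.mem_colon.2 fun j hj => ?_)
    rw [smul_eq_mul, mul_comm, ← Submodule.Quotient.mk_eq_zero, ← hψt,
      (Submodule.Quotient.mk_eq_zero J).2 hj, map_zero]
  · rw [smul_eq_mul, mul_comm]
    exact Submodule.mem_colon.1 ht s hs

/-! ### Rigidity as an ideal condition -/

theorem subsingleton_ext_one_iff {R : Type u} [CommRing R] {S : ShortComplex (ModuleCat.{u} R)}
    (hS : S.ShortExact) [Projective S.X₂] (N : ModuleCat.{u} R) :
    Subsingleton (Ext S.X₃ N 1) ↔ ∀ f : S.X₁ ⟶ N, ∃ g : S.X₂ ⟶ N, S.f ≫ g = f := by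
  refine ⟨fun h f => ?_, fun h => subsingleton_of_forall_eq 0 fun e => ?_⟩
  · obtain ⟨g', hg⟩ := Ext.contravariant_sequence_exact₁ hS N (Ext.mk₀ f) (add_zero 1)
      (Subsingleton.elim _ _)
    obtain ⟨g, rfl⟩ := Ext.addEquiv₀.symm.surjective g'
    refine ⟨g, (Ext.mk₀_bijective _ _).1 ?_⟩
    rw [← hg, Ext.addEquiv₀_symm_apply, Ext.mk₀_comp_mk₀]
  · obtain ⟨f', rfl⟩ := Ext.contravariant_sequence_exact₃ hS N e
      (Ext.eq_zero_of_projective _) (add_zero 1)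
    obtain ⟨f, rfl⟩ := Ext.addEquiv₀.symm.surjective f'
    obtain ⟨g, rfl⟩ := h f
    rw [Ext.addEquiv₀_symm_apply, ← Ext.mk₀_comp_mk₀, ← Ext.comp_assoc_of_second_deg_zero]
    simp

/-- Here `b * p - a * q` is the value at `(b, -a)` of the map `R² → I` with basis images `p` and
`q`. -/
theorem mem_span_pair_mul_self {R : Type u} [CommRing R] {a b c : R} {I : Ideal R}
    (hI : I = Ideal.span {a, b}) : c ∈ I * I ↔ ∃ p ∈ I, ∃ q ∈ I, c = b * p - a * q := by
  nth_rw 1 [hI]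
  rw [Ideal.span_insert, Ideal.sup_mul, Submodule.mem_sup]
  simp only [Ideal.mem_span_singleton_mul]
  constructor
  · rintro ⟨_, ⟨q, hq, rfl⟩, _, ⟨p, hp, rfl⟩, rfl⟩
    exact ⟨p, hp, -q, neg_mem hq, by ring⟩
  · rintro ⟨p, hp, q, hq, rfl⟩
    exact ⟨_, ⟨-q, neg_mem hq, rfl⟩, _, ⟨p, hp, rfl⟩, by ring⟩

/-- A two-generated ideal `I = (a, b)` with `b` regular is rigid if and only if every element
multiplying `(b) : a` into `bI` lies in `I²`. -/
theorem isRigidModule_span_pair_iff {R : Type u} [CommRing R] {a b : R} (hb : IsRegular b)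
    {I : Ideal R} (hI : I = Ideal.span {a, b}) :
    IsRigidModule R I ↔ ∀ c : R,
      (∀ x ∈ (Ideal.span {b}).colon {a}, x * c ∈ Ideal.span {b} * I) → c ∈ I * I := by
  have haI : a ∈ I := hI ▸ Ideal.subset_span (by simp)
  have hbI : b ∈ I := hI ▸ Ideal.subset_span (by simp)
  let π : (R × R) →ₗ[R] I := (LinearMap.toSpanSingleton R I ⟨a, haI⟩).coprod
    (LinearMap.toSpanSingleton R I ⟨b, hbI⟩)
  have hπ (w : R × R) : (π w : R) = w.1 * a + w.2 * b := by simp [π]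
  have hker (w : R × R) : w ∈ LinearMap.ker π ↔ w.1 * a + w.2 * b = 0 := by
    rw [LinearMap.mem_ker, Subtype.ext_iff, hπ]
    rfl
  have hsurj : Function.Surjective π := by
    rintro ⟨y, hy⟩
    rw [hI, Ideal.mem_span_pair] at hy
    obtain ⟨u, v, rfl⟩ := hy
    exact ⟨(u, v), Subtype.ext (hπ _)⟩
  let w₀ : LinearMap.ker π := ⟨(b, -a), (hker _).2 (by ring)⟩
  have hrig : IsRigidModule R I ↔ ∀ φ : LinearMap.ker π →ₗ[R] I,
      ∃ ψ : (R × R) →ₗ[R] I, ψ ∘ₗ (LinearMap.ker π).subtype = φ := by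
    have : Projective π.shortComplexKer.X₂ :=
      inferInstanceAs (Projective (ModuleCat.of R (R × R)))
    refine (subsingleton_ext_one_iff (LinearMap.shortExact_shortComplexKer hsurj)
      (ModuleCat.of R I)).trans ⟨fun h φ => ?_, fun h f => ?_⟩
    · obtain ⟨g, hg⟩ := h (ModuleCat.ofHom φ)
      exact ⟨g.hom, congrArg ModuleCat.Hom.hom hg⟩
    · obtain ⟨ψ, hψ⟩ := h f.hom
      exact ⟨ModuleCat.ofHom ψ, ModuleCat.hom_ext hψ⟩
  rw [hrig]
  constructor
  · intro h c hc
    -- The map to extend is `w ↦ w.1 * c / b`, with value `c` at `w₀`.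
    have hex (w : LinearMap.ker π) : ∃ z : I, b * (z : R) = w.1.1 * c := by
      have hw := (hker _).1 w.2
      obtain ⟨z, hz, hzw⟩ := Ideal.mem_span_singleton_mul.1 (hc w.1.1
        (Submodule.mem_colon_singleton.2 (Ideal.mem_span_singleton'.2
          ⟨-w.1.2, by rw [smul_eq_mul]; linear_combination -hw⟩)))
      exact ⟨⟨z, hz⟩, hzw⟩
    choose F hF using hex
    let φ : LinearMap.ker π →ₗ[R] I :=
      { toFun := F
        map_add' := fun w w' => Subtype.ext (hb.left (by
          simp only [Submodule.coe_add, mul_add, hF, Prod.fst_add, add_mul]))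
        map_smul' := fun r w => Subtype.ext (hb.left (by
          have := hF (r • w)
          have h' := hF w
          simp only [Submodule.coe_smul, Prod.smul_fst, smul_eq_mul, RingHom.id_apply] at this ⊢
          linear_combination this - r * h')) }
    obtain ⟨ψ, hψ⟩ := h φ
    have h0 : ((ψ (b, -a) : I) : R) = c := by
      have h1 : ψ (b, -a) = F w₀ := LinearMap.congr_fun hψ w₀
      rw [h1]
      exact hb.left (hF w₀)
    refine (mem_span_pair_mul_self hI).2 ⟨ψ (1, 0), (ψ (1, 0)).2, ψ (0, 1), (ψ (0, 1)).2, ?_⟩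
    have h2 : ((b, -a) : R × R) = b • (1, 0) - a • (0, 1) := by simp
    rw [← h0, h2, map_sub, map_smul, map_smul]
    rfl
  · intro h φ
    have hφ (w : LinearMap.ker π) : b * (φ w : R) = w.1.1 * φ w₀ := by
      have h1 : b • w = w.1.1 • w₀ := Subtype.ext (Prod.ext (mul_comm _ _) (by
        have := (hker _).1 w.2
        simp only [Submodule.coe_smul, Prod.smul_snd, smul_eq_mul, w₀]
        linear_combination this))
      have h2 := congrArg (fun w => (φ w : R)) h1
      simpa using h2
    obtain ⟨p, hp, q, hq, hc⟩ := (mem_span_pair_mul_self hI).1 (h (φ w₀) fun x hx => by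
      obtain ⟨y, hy⟩ := Ideal.mem_span_singleton'.1 (Submodule.mem_colon_singleton.1 hx)
      rw [smul_eq_mul] at hy
      exact Ideal.mem_span_singleton_mul.2 ⟨_, (φ ⟨(x, -y), (hker _).2 (by
        linear_combination -hy)⟩).2, hφ _⟩)
    refine ⟨(LinearMap.toSpanSingleton R I ⟨p, hp⟩).coprod
      (LinearMap.toSpanSingleton R I ⟨q, hq⟩), LinearMap.ext fun w => Subtype.ext (hb.left ?_)⟩
    have hw := (hker _).1 w.2
    have h1 := hφ w
    rw [hc] at h1
    simp only [LinearMap.comp_apply, Submodule.subtype_apply, LinearMap.coprod_apply,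
      LinearMap.toSpanSingleton_apply, Submodule.coe_add, Submodule.coe_smul, smul_eq_mul, h1]
    linear_combination q * hw

/-! ### Colon ideals and the main theorem -/

theorem span_singleton_mul_left_cancel {R : Type u} [CommRing R] {a : R} (ha : IsRegular a)
    {J K : Ideal R} : Ideal.span {a} * J = Ideal.span {a} * K ↔ J = K := by
  refine ⟨fun h => Ideal.ext fun x => ?_, fun h => h ▸ rfl⟩
  have hmem (L : Ideal R) : a * x ∈ Ideal.span {a} * L ↔ x ∈ L := by
    rw [Ideal.mem_span_singleton_mul]
    exact ⟨fun ⟨z, hz, hzx⟩ => ha.left hzx ▸ hz, fun hx => ⟨x, hx, rfl⟩⟩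
  rw [← hmem J, h, hmem]

theorem mem_colon_singleton_iff {R : Type u} [CommRing R] {a b x : R} :
    x ∈ (Ideal.span {b}).colon {a} ↔ ∃ y, y * b = x * a := by
  rw [Submodule.mem_colon_singleton, Ideal.mem_span_singleton', smul_eq_mul]

/-- Both sides are `(a) ∩ (b)`. -/
theorem span_singleton_mul_colon {R : Type u} [CommRing R] {a b : R} :
    Ideal.span {a} * (Ideal.span {b}).colon {a} = Ideal.span {b} * (Ideal.span {a}).colon {b} := by
  have key (a b : R) : Ideal.span {a} * (Ideal.span {b}).colon {a} ≤
      Ideal.span {b} * (Ideal.span {a}).colon {b} := by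
    intro z hz
    obtain ⟨x, hx, rfl⟩ := Ideal.mem_span_singleton_mul.1 hz
    obtain ⟨y, hy⟩ := mem_colon_singleton_iff.1 hx
    exact Ideal.mem_span_singleton_mul.2
      ⟨y, mem_colon_singleton_iff.2 ⟨x, hy.symm⟩, by linear_combination hy⟩
  exact le_antisymm (key a b) (key b a)

theorem mem_colon_mul_iff {R : Type u} [CommRing R] {L J K : Ideal R} {r : R} :
    r ∈ L.colon ((J * K : Ideal R) : Set R) ↔ ∀ x ∈ J, ∀ y ∈ K, r * (x * y) ∈ L := by
  rw [Submodule.mem_colon]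
  refine ⟨fun h x hx y hy => h _ (Ideal.mul_mem_mul hx hy), fun h s hs => ?_⟩
  induction hs using Submodule.mul_induction_on' with
  | mem_mul_mem x hx y hy => exact h x hx y hy
  | add x _ y _ hx hy => rw [smul_add]; exact add_mem hx hy

/-- The correspondence is `a * r = b * s`: the generator `ab` of `I²` puts `s` in `(a) : b`, `a²`
puts it in `(b) : a`, and `b²` imposes nothing. -/
theorem span_singleton_mul_colon_mul_self {R : Type u} [CommRing R] {a b : R} (hb : IsRegular b)
    {I : Ideal R} (hI : I = Ideal.span {a, b}) :
    Ideal.span {a} * (Ideal.span {b * b}).colon ((I * I : Ideal R) : Set R) =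
      Ideal.span {b} * ((Ideal.span {a}).colon {b} ⊓ (Ideal.span {b}).colon {a}) := by
  have haI : a ∈ I := hI ▸ Ideal.subset_span (by simp)
  have hbI : b ∈ I := hI ▸ Ideal.subset_span (by simp)
  apply le_antisymm
  · intro z hz
    obtain ⟨r, hr, rfl⟩ := Ideal.mem_span_singleton_mul.1 hz
    rw [mem_colon_mul_iff] at hr
    obtain ⟨s, hs⟩ := Ideal.mem_span_singleton'.1 (hr a haI b hbI)
    obtain ⟨t, ht⟩ := Ideal.mem_span_singleton'.1 (hr a haI a haI)
    have h1 : b * s = a * r := hb.left (by simp only; linear_combination hs)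
    refine Ideal.mem_span_singleton_mul.2 ⟨s, ⟨mem_colon_singleton_iff.2 ⟨r, ?_⟩,
      mem_colon_singleton_iff.2 ⟨t, hb.left ?_⟩⟩, h1⟩
    · linear_combination -h1
    · simp only
      linear_combination ht - a * h1
  · intro z hz
    obtain ⟨s, ⟨hs1, hs2⟩, rfl⟩ := Ideal.mem_span_singleton_mul.1 hz
    obtain ⟨r, hr⟩ := mem_colon_singleton_iff.1 hs1
    obtain ⟨t, ht⟩ := mem_colon_singleton_iff.1 hs2
    refine Ideal.mem_span_singleton_mul.2
      ⟨r, mem_colon_mul_iff.2 fun x hx y hy => ?_, by linear_combination hr⟩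
    rw [hI, Ideal.mem_span_pair] at hx hy
    obtain ⟨u, v, rfl⟩ := hx
    obtain ⟨u', v', rfl⟩ := hy
    refine Ideal.mem_span_singleton'.2 ⟨u * u' * t + (u * v' + u' * v) * s + v * v' * r, ?_⟩
    linear_combination (u * u' * b) * ht - (u * u' * a + (u * v' + u' * v) * b) * hr

theorem corollary4p9 {R : Type u} [CommRing R] [IsGorensteinLocalRing R]
    (hdim : ringKrullDim R = 1) (a b : R) (ha : IsRegular a) (hb : IsRegular b)
    (I : Ideal R) (hI : I = Ideal.span {a, b}) :
    IsRigidModule R I ↔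
      (Ideal.span {a}).colon {b} ⊓ (Ideal.span {b}).colon {a} =
        (Ideal.span {a}).colon {b} * (Ideal.span {b}).colon {a} := by
  have hbI : b ∈ I := hI ▸ Ideal.subset_span (by simp)
  have hbb : IsRegular (b * b) := hb.mul hb
  set K := (Ideal.span {b}).colon {a} with hK
  have hbK : b ∈ K := mem_colon_singleton_iff.2 ⟨a, mul_comm _ _⟩
  have hKI : (Ideal.span {b}).colon (I : Set R) = K := by
    rw [hI, Ideal.colon_span, Set.insert_eq, Submodule.colon_union, ← hK, inf_eq_left]
    exact fun x _ => mem_colon_singleton_iff.2 ⟨x, rfl⟩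
  have hIK : (Ideal.span {b}).colon (K : Set R) = I := by
    rw [← hKI, span_singleton_colon_colon hdim.le hb hbI]
  have hD (c : R) : (∀ x ∈ K, x * c ∈ Ideal.span {b} * I) ↔
      c ∈ (Ideal.span {b * b}).colon ((K * K : Ideal R) : Set R) := by
    rw [mem_colon_mul_iff]
    refine ⟨fun h x hx y hy => ?_, fun h x hx => ?_⟩
    · obtain ⟨z, hz, hzx⟩ := Ideal.mem_span_singleton_mul.1 (h x hx)
      rw [← hIK] at hz
      obtain ⟨w, hw⟩ := Ideal.mem_span_singleton'.1 (Submodule.mem_colon.1 hz y hy)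
      rw [smul_eq_mul] at hw
      exact Ideal.mem_span_singleton'.2 ⟨w, by linear_combination b * hw + y * hzx⟩
    -- Testing against `b ∈ K` makes `x * c` divisible by `b`.
    · obtain ⟨z, hz⟩ := Ideal.mem_span_singleton'.1 (h x hx b hbK)
      have hz' : b * z = x * c := hb.left (by simp only; linear_combination hz)
      refine Ideal.mem_span_singleton_mul.2 ⟨z, ?_, hz'⟩
      rw [← hIK]
      refine Submodule.mem_colon.2 fun y hy => ?_
      obtain ⟨w, hw⟩ := Ideal.mem_span_singleton'.1 (h x hx y hy)
      exact Ideal.mem_span_singleton'.2 ⟨w, hb.left (by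
        simp only [smul_eq_mul]; linear_combination hw - y * hz')⟩
  have hle : I * I ≤ (Ideal.span {b * b}).colon ((K * K : Ideal R) : Set R) := fun c hc => by
    rw [← hD]
    intro x hx
    obtain ⟨p, hp, q, hq, rfl⟩ := (mem_span_pair_mul_self hI).1 hc
    obtain ⟨y, hy⟩ := mem_colon_singleton_iff.1 hx
    exact Ideal.mem_span_singleton_mul.2 ⟨x * p - y * q,
      sub_mem (I.mul_mem_left _ hp) (I.mul_mem_left _ hq), by linear_combination -q * hy⟩
  have hrigid : IsRigidModule R I ↔
      (Ideal.span {b * b}).colon ((K * K : Ideal R) : Set R) = I * I := by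
    rw [isRigidModule_span_pair_iff hb hI, ← hK]
    simp only [hD]
    exact ⟨fun h => le_antisymm h hle, fun h => h.le⟩
  have hdual : (Ideal.span {b * b}).colon ((K * K : Ideal R) : Set R) = I * I ↔
      (Ideal.span {b * b}).colon ((I * I : Ideal R) : Set R) = K * K := by
    constructor
    · intro h
      rw [← h, span_singleton_colon_colon hdim.le hbb (Ideal.mul_mem_mul hbK hbK)]
    · intro h
      rw [← h, span_singleton_colon_colon hdim.le hbb (Ideal.mul_mem_mul hbI hbI)]
  rw [hrigid, hdual, ← span_singleton_mul_left_cancel ha, span_singleton_mul_colon_mul_self hb hI,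
    ← mul_assoc, hK, span_singleton_mul_colon, mul_assoc, span_singleton_mul_left_cancel hb]
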